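/- All graphs are finite and simple. For a graph $G$ with adjacency matrix $A$, let $\phi^G$ be the characteristic polynomial of $A$, let $\Phi(G)$ be the set of eigenvalues of $A$, and for an eigenvalue $\theta$ let $E_\theta$ be the orthogonal projection onto its eigenspace. For a vertex $i$ with characteristic vector $e_i$, let $\Phi_i(G)=\{\theta\in\Phi(G): E_\theta e_i\neq 0\}$ be its eigenvalue support. Vertices $i,j$ are cospectral if $\phi^{G\setminus i}=\phi^{G\setminus j}$, and strongly cospectral if $E_\theta e_i=\pm E_\theta e_j$ for every $\theta\in\Phi(G)$. A graph is integral if all elements of $\Phi(G)$ are integers. The minimum distance between elements of a set $S$ of reals means $\min\{|x-y| : x,y\in S,\ x\neq y\}$. **Theorem.** There exists a sequence $(T_n)$ of integral trees, each with a pair of cospectral vertices at distance $2$, such that the minimum distance between elements of $\Phi(T_n)$ tends to $\infty$ as $n\to\infty$. Moreover, consider the following assertion: if $i$ and $j$ are strongly cospectral vertices of a graph $G$ with neighbors $i'\neq j$ and $j'\neq i$, respectively, such that $ii'$ and $jj'$ are cut-edges each of which separates $i$ and $j$ into different connected components, then the minimum distance between elements of $\Phi_i(G)$ is at most $\sqrt2$.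 If "strongly cospectral" is replaced by "cospectral" in it, the resulting assertion is false, even if $G$ is required to be a tree. -/

import Mathlib

open Filter

/-- The adjacency operator `A(G)` of a finite graph, acting on `ℝ^V` with its Euclidean structure. -/
noncomputable def adjOperator {V : Type*} [Fintype V] (G : SimpleGraph V) :
    EuclideanSpace ℝ V →ₗ[ℝ] EuclideanSpace ℝ V := by
  classical exact Matrix.toEuclideanLin (G.adjMatrix ℝ)

/-- `Φ(G)`: the set of eigenvalues of the adjacency matrix. It is symmetric, so every eigenvalue
is real. -/
def graphSpectrum {V : Type*} [Fintype V] (G : SimpleGraph V) : Set ℝ :=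
  {θ | Module.End.HasEigenvalue (adjOperator G) θ}

/-- A graph is integral if all its eigenvalues are integers. -/
def IsIntegralGraph {V : Type*} [Fintype V] (G : SimpleGraph V) : Prop :=
  ∀ θ ∈ graphSpectrum G, ∃ k : ℤ, θ = k

/-- `φ^G`: the characteristic polynomial of the adjacency matrix. -/
noncomputable def graphCharpoly {V : Type*} [Finite V] (G : SimpleGraph V) : Polynomial ℝ := by
  classical exact
    haveI := Fintype.ofFinite V
    (G.adjMatrix ℝ).charpoly

/-- Vertices `i` and `j` are cospectral if `φ^{G ∖ i} = φ^{G ∖ j}`. -/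
def Cospectral {V : Type*} [Finite V] (G : SimpleGraph V) (i j : V) : Prop :=
  graphCharpoly (G.induce {v | v ≠ i}) = graphCharpoly (G.induce {v | v ≠ j})

/-- `Φ_i(G)`: the eigenvalue support of `i`, that is the eigenvalues `θ` with `E_θ e_i ≠ 0`, where
`E_θ` is the orthogonal projection onto the eigenspace of `θ`. -/
def eigenvalueSupport {V : Type*} [Fintype V] [DecidableEq V] (G : SimpleGraph V) (i : V) :
    Set ℝ :=
  {θ | θ ∈ graphSpectrum G ∧
    (Module.End.eigenspace (adjOperator G) θ).starProjection (EuclideanSpace.single i 1) ≠ 0}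

/-- The distances between distinct elements of a set of reals. -/
def pairDistances (S : Set ℝ) : Set ℝ :=
  {r | ∃ x ∈ S, ∃ y ∈ S, x ≠ y ∧ r = |x - y|}

/-- `d` is the minimum distance between (distinct) elements of `S`. -/
def IsMinDistance (S : Set ℝ) (d : ℝ) : Prop :=
  IsLeast (pairDistances S) d

/-- `ab` is a cut-edge of `G` whose removal puts `i` and `j`, which lie in the same component
of `G`, into different components. -/
def IsSeparatingCutEdge {V : Type*} (G : SimpleGraph V) (a b i j : V) : Prop :=
  G.Adj a b ∧ G.Reachable i j ∧ ¬ (G.deleteEdges {s(a, b)}).Reachable i j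

open SimpleGraph

/-! The star with `k ^ 2` leaves, `k ≥ 2`, settles both claims. Its eigenvalues are exactly `0`, `k`
and `-k`, so it is an integral tree whose minimum eigenvalue gap `k` is unbounded. Any two leaves
are exchanged by an automorphism, hence cospectral, and they lie at distance 2 through the centre.
Every leaf sees the whole spectrum in its support, and its only edge is a cut-edge isolating it.
Thus `k = 2` already gives a support gap of `2 > √2`. -/

/-- The eigenvalue equation of the adjacency operator, vertex by vertex. -/
theorem mem_eigenspace_adjOperator_iff {V : Type*} [Fintype V] [DecidableEq V]
    (G : SimpleGraph V) [DecidableRel G.Adj] (θ : ℝ) (v : EuclideanSpace ℝ V) :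
    v ∈ Module.End.eigenspace (adjOperator G) θ ↔
      ∀ i, ∑ j, (if G.Adj i j then v j else 0) = θ * v i := by
  rw [Module.End.mem_eigenspace_iff]
  constructor
  · intro h i
    have := congrArg (fun w : EuclideanSpace ℝ V => w i) h
    simp only [PiLp.smul_apply, smul_eq_mul] at this
    rw [← this]
    simp [adjOperator, Matrix.toLpLin_apply, Matrix.mulVec, dotProduct, adjMatrix_apply]
  · intro h
    ext i
    simp only [PiLp.smul_apply, smul_eq_mul]
    rw [← h i]
    simp [adjOperator, Matrix.toLpLin_apply, Matrix.mulVec, dotProduct, adjMatrix_apply]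

/-- An eigenvalue with an eigenvector that does not vanish at `i` lies in the support of `i`. -/
theorem mem_eigenvalueSupport_of_mem_eigenspace {V : Type*} [Fintype V] [DecidableEq V]
    {G : SimpleGraph V} {i : V} {θ : ℝ} {v : EuclideanSpace ℝ V}
    (hv : v ∈ Module.End.eigenspace (adjOperator G) θ) (hi : v i ≠ 0) :
    θ ∈ eigenvalueSupport G i := by
  have hv0 : v ≠ 0 := by
    rintro rfl
    simp at hi
  refine ⟨Module.End.hasEigenvalue_of_hasEigenvector ⟨hv, hv0⟩, fun h => hi ?_⟩
  -- A vanishing projection makes `e_i` orthogonal to `v`, and that inner product is the entry `v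
  -- i`.
  rw [Submodule.starProjection_apply_eq_zero_iff, Submodule.mem_orthogonal] at h
  simpa [EuclideanSpace.inner_single_right] using h v hv

/-- Isomorphic graphs have the same characteristic polynomial. -/
theorem graphCharpoly_congr {V W : Type*} [Finite V] [Finite W] {G : SimpleGraph V}
    {H : SimpleGraph W} (e : G ≃g H) : graphCharpoly G = graphCharpoly H := by
  classical
  unfold graphCharpoly
  let _ := Fintype.ofFinite V
  let _ := Fintype.ofFinite W
  rw [← Matrix.charpoly_reindex e.toEquiv]
  congr 1
  ext i j
  have : G.Adj (e.toEquiv.symm i) (e.toEquiv.symm j) ↔ H.Adj i j := e.symm.map_adj_iff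
  simp only [Matrix.reindex_apply, Matrix.submatrix_apply, adjMatrix_apply, this]

/-- Vertices in the same orbit of the automorphism group are cospectral. -/
theorem cospectral_of_automorphism {V : Type*} [Finite V] {G : SimpleGraph V} (e : G ≃g G)
    {i j : V} (h : e i = j) : Cospectral G i j := by
  refine graphCharpoly_congr ⟨e.toEquiv.subtypeEquiv fun a => ?_, ?_⟩
  · subst h
    exact (e.injective.ne_iff (x := a) (y := i)).symm
  · intro a b
    exact e.map_adj_iff

/-- A permutation fixing the centre of a star is an automorphism. -/
def starGraphIso {V : Type*} {r : V} (e : V ≃ V) (h : e r = r) : starGraph r ≃g starGraph r where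
  toEquiv := e
  map_rel_iff' := by
    intro a b
    have hr : ∀ x, e x = r ↔ x = r := fun x => by
      conv_lhs => rw [← h]
      exact e.injective.eq_iff
    simp [hr]

theorem cospectral_starGraph {V : Type*} [Finite V] {r i j : V} (hi : i ≠ r) (hj : j ≠ r) :
    Cospectral (starGraph r) i j := by
  classical
  exact cospectral_of_automorphism
    (starGraphIso (Equiv.swap i j) (Equiv.swap_apply_of_ne_of_ne hi.symm hj.symm))
    (Equiv.swap_apply_left i j)

theorem dist_starGraph {V : Type*} {r i j : V} (hi : i ≠ r) (hj : j ≠ r) (hij : i ≠ j) :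
    (starGraph r).dist i j = 2 := by
  have h1 : 1 < (starGraph r).dist i j :=
    (connected_starGraph r).one_lt_dist_of_ne_of_not_adj hij (by simp [hi, hj])
  have h2 := dist_le (.cons (starGraph_center_adj' hi.symm)
    (.cons (starGraph_center_adj hj.symm) .nil) : (starGraph r).Walk i j)
  simp only [Walk.length_cons, Walk.length_nil] at h2
  omega

/-- Deleting the only edge at the leaf `i` leaves it isolated. -/
theorem isSeparatingCutEdge_starGraph_left {V : Type*} {r i j : V} (hi : i ≠ r) (hij : i ≠ j) :
    IsSeparatingCutEdge (starGraph r) i r i j := by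
  refine ⟨starGraph_center_adj' hi.symm, connected_starGraph r i j, fun h => ?_⟩
  refine not_reachable_of_neighborSet_right_eq_empty hij.symm ?_ h.symm
  ext x
  simp only [mem_neighborSet, deleteEdges_adj, starGraph_adj, Set.mem_singleton_iff,
    Set.mem_empty_iff_false, iff_false]
  rintro ⟨⟨-, h | rfl⟩, h'⟩
  · exact hi h
  · exact h' rfl

theorem IsSeparatingCutEdge.symm {V : Type*} {G : SimpleGraph V} {a b i j : V}
    (h : IsSeparatingCutEdge G a b i j) : IsSeparatingCutEdge G a b j i :=
  ⟨h.1, h.2.1.symm, fun h' => h.2.2 h'.symm⟩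

/-- The eigenvalue equation of the star with `N` leaves. -/
theorem mem_eigenspace_starGraph_iff {N : ℕ} (θ : ℝ) (v : EuclideanSpace ℝ (Fin (N + 1))) :
    v ∈ Module.End.eigenspace (adjOperator (starGraph (0 : Fin (N + 1)))) θ ↔
      ∑ l : Fin N, v l.succ = θ * v 0 ∧ ∀ l : Fin N, v 0 = θ * v l.succ := by
  rw [mem_eigenspace_adjOperator_iff, Fin.forall_fin_succ]
  simp [Fin.sum_univ_succ, Fin.succ_ne_zero, (Fin.succ_ne_zero _).symm]

/-- For `θ ≠ 0` the leaf equations make an eigenvector vanish everywhere once it vanishes at the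
centre. So its central entry is nonzero, and multiplying the centre equation by `θ` gives `θ ^ 2 = k
^ 2`. -/
theorem eq_of_mem_graphSpectrum_starGraph_sq {k : ℕ} {θ : ℝ}
    (h : θ ∈ graphSpectrum (starGraph (0 : Fin (k ^ 2 + 1)))) :
    θ = 0 ∨ θ = k ∨ θ = -k := by
  obtain ⟨v, hv, hv0⟩ := Module.End.HasEigenvalue.exists_hasEigenvector h
  obtain ⟨h0, hl⟩ := (mem_eigenspace_starGraph_iff θ v).1 hv
  refine or_iff_not_imp_left.2 fun hθ => sq_eq_sq_iff_eq_or_eq_neg.1 ?_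
  have hc : v 0 ≠ 0 := by
    intro hc
    apply hv0
    ext l
    refine Fin.cases hc (fun l => ?_) l
    have := hl l
    rw [hc] at this
    exact (mul_eq_zero.1 this.symm).resolve_left hθ
  refine mul_right_cancel₀ hc ?_
  calc θ ^ 2 * v 0 = θ * (θ * v 0) := by ring
    _ = ∑ l : Fin (k ^ 2), θ * v l.succ := by rw [← h0, Finset.mul_sum]
    _ = ∑ _l : Fin (k ^ 2), v 0 := Finset.sum_congr rfl fun l _ => (hl l).symm
    _ = (k : ℝ) ^ 2 * v 0 := by simp

/-- The eigenvalue support of a leaf of the star with `k ^ 2` leaves contains `0`, `k`, `-k`. -/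
theorem mem_eigenvalueSupport_starGraph_sq {k : ℕ} {i j : Fin (k ^ 2)} (hij : i ≠ j) {θ : ℝ}
    (h : θ = 0 ∨ θ = k ∨ θ = -k) :
    θ ∈ eigenvalueSupport (starGraph (0 : Fin (k ^ 2 + 1))) i.succ := by
  rcases eq_or_ne θ 0 with rfl | hθ
  -- The kernel vector `e_i - e_j` is where a second leaf is needed.
  · refine mem_eigenvalueSupport_of_mem_eigenspace
      (v := EuclideanSpace.single i.succ 1 - EuclideanSpace.single j.succ 1)
      ((mem_eigenspace_starGraph_iff _ _).2 ⟨?_, fun l => ?_⟩) ?_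
    · simp
    · simp [(Fin.succ_ne_zero _).symm]
    · simp [hij]
  · have hsq : θ ^ 2 = (k : ℝ) ^ 2 := sq_eq_sq_iff_eq_or_eq_neg.2 (h.resolve_left hθ)
    -- Eigenvector for `±k`: `θ` at the centre and 1 on every leaf.
    refine mem_eigenvalueSupport_of_mem_eigenspace
      (v := WithLp.toLp 2 (Fin.cons θ fun _ => 1))
      ((mem_eigenspace_starGraph_iff _ _).2 ⟨?_, fun l => ?_⟩) ?_
    · simpa [← sq] using hsq.symm
    · simp
    · simp

theorem isMinDistance_zero_neg {S : Set ℝ} {k : ℝ} (hk : 0 < k)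
    (hS : ∀ θ, θ ∈ S ↔ θ = 0 ∨ θ = k ∨ θ = -k) : IsMinDistance S k := by
  refine ⟨⟨k, (hS k).2 (by simp), 0, (hS 0).2 (by simp), hk.ne', by simp [abs_of_pos hk]⟩, ?_⟩
  rintro _ ⟨x, hx, y, hy, hxy, rfl⟩
  rw [le_abs]
  rcases (hS x).1 hx with rfl | rfl | rfl <;> rcases (hS y).1 hy with rfl | rfl | rfl <;>
    first
    | exact absurd rfl hxy
    | (left; linarith)
    | (right; linarith)

theorem exists_pair_fin_sq {k : ℕ} (hk : 2 ≤ k) : ∃ i j : Fin (k ^ 2), i ≠ j := by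
  have : 1 < k ^ 2 := Nat.one_lt_pow two_ne_zero hk
  exact ⟨⟨0, by omega⟩, ⟨1, this⟩, by simp⟩

theorem isMinDistance_eigenvalueSupport_starGraph_sq {k : ℕ} (hk : 2 ≤ k) {i j : Fin (k ^ 2)}
    (hij : i ≠ j) :
    IsMinDistance (eigenvalueSupport (starGraph (0 : Fin (k ^ 2 + 1))) i.succ) k :=
  isMinDistance_zero_neg (by exact_mod_cast (by omega : 0 < k)) fun _ =>
    ⟨fun h => eq_of_mem_graphSpectrum_starGraph_sq h.1, mem_eigenvalueSupport_starGraph_sq hij⟩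

theorem isMinDistance_graphSpectrum_starGraph_sq {k : ℕ} (hk : 2 ≤ k) :
    IsMinDistance (graphSpectrum (starGraph (0 : Fin (k ^ 2 + 1)))) k := by
  obtain ⟨i, j, hij⟩ := exists_pair_fin_sq hk
  exact isMinDistance_zero_neg (by exact_mod_cast (by omega : 0 < k)) fun _ =>
    ⟨eq_of_mem_graphSpectrum_starGraph_sq, fun h => (mem_eigenvalueSupport_starGraph_sq hij h).1⟩

theorem isIntegralGraph_starGraph_sq (k : ℕ) :
    IsIntegralGraph (starGraph (0 : Fin (k ^ 2 + 1))) := by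
  intro θ hθ
  rcases eq_of_mem_graphSpectrum_starGraph_sq hθ with rfl | rfl | rfl
  · exact ⟨0, by simp⟩
  · exact ⟨k, by simp⟩
  · exact ⟨-k, by simp⟩

theorem mainTheorem5 :
    (∃ (N : ℕ → ℕ) (T : ∀ n, SimpleGraph (Fin (N n))) (d : ℕ → ℝ),
      (∀ n, (T n).IsTree ∧ IsIntegralGraph (T n) ∧
        (∃ i j : Fin (N n), Cospectral (T n) i j ∧ (T n).dist i j = 2) ∧
        IsMinDistance (graphSpectrum (T n)) (d n)) ∧
      Tendsto d atTop atTop) ∧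
    ¬ (∀ (m : ℕ) (G : SimpleGraph (Fin m)) (i j i' j' : Fin m),
        G.IsTree → Cospectral G i j → i' ≠ j → j' ≠ i →
        IsSeparatingCutEdge G i i' i j → IsSeparatingCutEdge G j j' i j →
        ∀ δ : ℝ, IsMinDistance (eigenvalueSupport G i) δ → δ ≤ √2) := by
  constructor
  -- The shift `k = n + 2` guarantees two distinct leaves.
  · refine ⟨fun n => (n + 2) ^ 2 + 1, fun n => starGraph 0, fun n => ((n + 2 : ℕ) : ℝ),
      fun n => ⟨isTree_starGraph 0, isIntegralGraph_starGraph_sq (n + 2), ?_,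
        isMinDistance_graphSpectrum_starGraph_sq (by omega)⟩, ?_⟩
    · obtain ⟨i, j, hij⟩ := exists_pair_fin_sq (k := n + 2) (by omega)
      exact ⟨i.succ, j.succ, cospectral_starGraph i.succ_ne_zero j.succ_ne_zero,
        dist_starGraph i.succ_ne_zero j.succ_ne_zero ((Fin.succ_injective _).ne hij)⟩
    · exact tendsto_natCast_atTop_atTop.comp (tendsto_add_atTop_nat 2)
  · intro h
    obtain ⟨i, j, hij⟩ := exists_pair_fin_sq (k := 2) le_rfl
    have hne : i.succ ≠ j.succ := (Fin.succ_injective _).ne hij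
    -- The centre `0` serves as both `i'` and `j'`.
    have hle := h _ (starGraph 0) i.succ j.succ 0 0 (isTree_starGraph 0)
      (cospectral_starGraph i.succ_ne_zero j.succ_ne_zero) j.succ_ne_zero.symm i.succ_ne_zero.symm
      (isSeparatingCutEdge_starGraph_left i.succ_ne_zero hne)
      (isSeparatingCutEdge_starGraph_left j.succ_ne_zero hne.symm).symm _
      (isMinDistance_eigenvalueSupport_starGraph_sq le_rfl hij)
    have hlt : √2 < ((2 : ℕ) : ℝ) := by
      rw [Real.sqrt_lt' (by norm_num)]
      norm_num
    exact absurd hle hlt.not_ge
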